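/- Let $p,q,r,s,l\ge 0$ be integers with $l\le p$, and let $(V,(\cdot,\cdot))$ be a non-degenerate quadratic space over $\mathbb R$ (orthogonal case), resp. hermitian space over $\mathbb C$ (unitary case), of signature $(p,q)$, with isometry group $G$. Let $D=G/K$ be its symmetric space: the space of oriented negative definite $q$-planes in the orthogonal case, of negative definite $q$-planes in the unitary case. Fix an orthonormal basis $v_1,\dots,v_{p+q}$ of $V$, with $(v_i,v_i)=1$ for $i\le p$ and $(v_{p+j},v_{p+j})=-1$; the base point is $o=\langle v_{p+1},\dots,v_{p+q}\rangle\in D$, and $\xi_{i,j}$ denotes the $(i,j)$ matrix coefficient on $T_oD=\mathrm{Hom}(o,o^\perp)$. Let $X_{i,a}$ denote the $i$-th coordinate of the $a$-th vector. *Orthogonal case.* $\varphi^{(rq)}\in[\mathcal S(V^r)\otimes\Omega^{rq}(D)]^G$ is the $G$-invariant form whose value at $o$ is $$\prod_{a=1}^r\prod_{j=1}^q\Big(\sum_{i=1}^p \xi_{i,j}\otimes\tfrac12\big(X_{i,a}-\tfrac1{2\pi}\tfrac{\partial}{\partial X_{i,a}}\big)\Big)\cdot\exp\Big(-\pi\sum_{a=1}^r\sum_{c=1}^{p+q}X_{c,a}^2\Big),$$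 where $G$ acts on $\mathcal S(V^r)$ by $(\omega(g)f)(x)=f(g^{-1}x)$. (Here $G'=Sp(2r)$, and $\varphi^{(rq,sq)}$ means $\varphi^{(rq)}$.) *Unitary case.* Put $m=\min(r,s)$, $k=|r-s|$. The oscillator representation $\omega$ of $G$ for the pair $(G',G)=(U(r,s),U(p,q))$ is realized in the mixed model of functions on $V^m\times V^k$: Schrödinger model on $V^m$ (with $(\omega(g)f)(x)=f(g^{-1}x)$), and on $V^k$ the Fock model attached to the complex structure $i$ on $o^\perp$, $-i$ on $o$ (its complex conjugate if $r>s$), in which $(k_1,k_2)\in U(p)\times U(q)$ acts by $P\mapsto\det(k_2)^kP\circ (k_1,k_2)^{-1}$ (complex conjugated if $r>s$). The $G$-invariant form $\varphi^{(rq,sq)}$ on $D$, of type $(rq,sq)$, has value $\varphi_1\wedge\dots\wedge\varphi_m\wedge\psi_{m+1}\wedge\dots\wedge\psi_{m+k}$ at $o$, where $$\varphi_a=\prod_{j=1}^q\nabla_{a,j}\overline\nabla_{a,j}\cdot\exp\Big(-\pi\sum_{c=1}^{p+q}|X_{c,a}|^2\Big),\qquad \nabla_{a,j}=\sum_{i=1}^p\overline\xi_{i,j}\otimes\tfrac12\big(X_{i,a}-\tfrac1\pi\tfrac{\partial}{\partial\overline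 X_{i,a}}\big),$$ $$\psi_a=\sum_{1\le i_1,\dots,i_q\le p}X_{i_1,a}\cdots X_{i_q,a}\;\overline\xi_{i_1,1}\wedge\dots\wedge\overline\xi_{i_q,q}$$ ($\psi_a$ being replaced by its complex conjugate if $r>s$). Let $U\subset V$ be a positive definite subspace of dimension $l$, let $G_U\subset G$ be the pointwise stabilizer of $U$, identified with the isometry group of $U^\perp$, and let $D_U\subset D$ be its symmetric space, which is the symmetric space of $U^\perp$. Then there are orthonormal bases of $V$ as above that are adapted to $U$, i.e. such that $v_1,\dots,v_l$ is a basis of $U$ and $v_{l+1},\dots,v_{p+q}$ is a basis of $U^\perp$ (so that $o\in D_U$). For every such basis, let $\varphi_{U^\perp}^{(rq,sq)}$ be the form on $D_U$ constructed as above for $U^\perp$ with the basis $v_{l+1},\dots,v_{p+q}$, and let $\varphi_+^0$ be the Gaussian of $U$: $$\varphi_+^0(u)=\exp\Big(-\pi\sum_a(u_a,u_a)\Big),$$ the sum being over all $r$ variables in the orthogonal case, and over the $m$ Schrödinger variables in the unitary case ($\varphi_+^0$ is constant in the Fock variables). Then the restriction map $\Omega^*(D)\to\Omega^*(D_U)$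 sends $\varphi^{(rq,sq)}$ to $$\varphi_+^0\otimes\varphi_{U^\perp}^{(rq,sq)},$$ where functions of $x=u+w$ (with $u$ in copies of $U$ and $w$ in copies of $U^\perp$) are regarded as functions of $(u,w)$. -/

import Mathlib

noncomputable section

open scoped ComplexConjugate

namespace Seesaw

/-! ### Hermitian spaces, orthonormal frames, isometry groups -/

section Geometry

variable {𝕜 V : Type*} [RCLike 𝕜] [AddCommGroup V] [Module 𝕜 V]

/-- `b` is an orthonormal frame of `(V, h)`: its first vectors (indexed by `ι`) have square `1`,
its last vectors (indexed by `κ`) have square `-1`, and distinct vectors are orthogonal.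
The span of the last vectors is a maximal negative definite subspace, i.e. a base point `o` of the
symmetric space `D` of `(V, h)`. The form `h` is conjugate-linear in the first variable
(for `𝕜 = ℝ` the conjugation is trivial, and `h` is a symmetric bilinear form). -/
def IsFrame {ι κ : Type*} (h : V →ₗ⋆[𝕜] V →ₗ[𝕜] 𝕜) (b : Module.Basis (ι ⊕ κ) 𝕜 V) : Prop :=
  (∀ i, h (b (Sum.inl i)) (b (Sum.inl i)) = 1) ∧
  (∀ j, h (b (Sum.inr j)) (b (Sum.inr j)) = -1) ∧
  ∀ c d, c ≠ d → h (b c) (b d) = 0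

/-- `(V, h)` is a nondegenerate quadratic (hermitian) space of signature `(p, q)`. -/
def HasSignature (h : V →ₗ⋆[𝕜] V →ₗ[𝕜] 𝕜) (p q : ℕ) : Prop :=
  ∃ b : Module.Basis (Fin p ⊕ Fin q) 𝕜 V, IsFrame h b

/-- `U` is a positive definite subspace. -/
def IsPosDefOn (h : V →ₗ⋆[𝕜] V →ₗ[𝕜] 𝕜) (U : Submodule 𝕜 V) : Prop :=
  ∀ u ∈ U, u ≠ 0 → 0 < RCLike.re (h u u)

/-- The group `G` of isometries of `(V, h)`. -/
def isometries (h : V →ₗ⋆[𝕜] V →ₗ[𝕜] 𝕜) : Subgroup (V ≃ₗ[𝕜] V) where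
  carrier := {g | ∀ x y, h (g x) (g y) = h x y}
  one_mem' := fun _ _ => rfl
  mul_mem' := by
    intro a c ha hc x y
    rw [LinearEquiv.mul_apply, LinearEquiv.mul_apply, ha, hc]
  inv_mem' := by
    intro a ha x y
    have e := ha (a⁻¹ x) (a⁻¹ y)
    have key : ∀ z : V, a (a⁻¹ z) = z := fun z => LinearEquiv.apply_symm_apply a z
    rw [key, key] at e
    exact e.symm

/-- The orthogonal complement `U^⊥`. -/
abbrev perp (h : V →ₗ⋆[𝕜] V →ₗ[𝕜] 𝕜) (U : Submodule 𝕜 V) : Submodule 𝕜 V :=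
  U.orthogonalBilin h

/-- The form induced by `h` on a subspace. -/
def resForm (h : V →ₗ⋆[𝕜] V →ₗ[𝕜] 𝕜) (W : Submodule 𝕜 V) : W →ₗ⋆[𝕜] W →ₗ[𝕜] 𝕜 :=
  h.domRestrict₁₂ W W

/-- The subgroup `G_U` of `G` of the isometries that fix `U` pointwise. -/
def fixer (h : V →ₗ⋆[𝕜] V →ₗ[𝕜] 𝕜) (U : Submodule 𝕜 V) : Subgroup (isometries h) where
  carrier := {g | ∀ u ∈ U, g.1 u = u}
  one_mem' := fun _ _ => rfl
  mul_mem' := by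
    intro a c ha hc u hu
    change a.1 (c.1 u) = u
    rw [hc u hu, ha u hu]
  inv_mem' := by
    intro a ha u hu
    change a.1.symm u = u
    rw [LinearEquiv.symm_apply_eq, ha u hu]

theorem fixer_maps (h : V →ₗ⋆[𝕜] V →ₗ[𝕜] 𝕜) (U : Submodule 𝕜 V) (g : fixer h U) :
    ∀ x ∈ perp h U, (g.1.1 : V →ₗ[𝕜] V) x ∈ perp h U := by
  intro x hx u hu
  have e : h (g.1.1 u) (g.1.1 x) = h u x := g.1.2 u x
  rw [g.2 u hu] at e
  change h u (g.1.1 x) = 0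
  rw [e]
  exact hx u hu

/-- The isomorphism `G_U → G(U^⊥)`: an isometry of `V` that fixes `U` pointwise acts on `U^⊥`. -/
def fixerToPerp (h : V →ₗ⋆[𝕜] V →ₗ[𝕜] 𝕜) (U : Submodule 𝕜 V) (g : fixer h U) :
    isometries (resForm h (perp h U)) :=
  ⟨LinearEquiv.ofLinearMap
      ((g.1.1 : V →ₗ[𝕜] V).restrict (fixer_maps h U g))
      (((g⁻¹).1.1 : V →ₗ[𝕜] V).restrict (fixer_maps h U g⁻¹))
      (by
        ext x
        exact LinearEquiv.apply_symm_apply g.1.1 (x : V))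
      (by
        ext x
        exact LinearEquiv.symm_apply_apply g.1.1 (x : V)),
    fun x y => g.1.2 (x : V) (y : V)⟩

variable [Module ℝ V] [SMulCommClass 𝕜 ℝ V]

/-- The Lie algebra `𝔤₀` of `G`: the endomorphisms that are skew for `h`. -/
def lieAlg (h : V →ₗ⋆[𝕜] V →ₗ[𝕜] 𝕜) [IsScalarTower ℝ 𝕜 V] : Submodule ℝ (V →ₗ[𝕜] V) where
  carrier := {A | ∀ x y, h (A x) y + h x (A y) = 0}
  zero_mem' := by intro x y; simp
  add_mem' := by
    intro A C hA hC x y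
    have e1 := hA x y
    have e2 := hC x y
    simp only [LinearMap.add_apply, map_add]
    linear_combination e1 + e2
  smul_mem' := by
    intro t A hA x y
    have e1 := hA x y
    have e : ∀ z : V, t • z = (t : 𝕜) • z := fun z => by
      rw [← RCLike.real_smul_eq_coe_smul]
    simp only [LinearMap.smul_apply, e, map_smulₛₗ, RCLike.conj_ofReal, LinearMap.smul_apply,
      smul_eq_mul, RingHom.id_apply]
    linear_combination (t : 𝕜) * e1

variable [IsScalarTower ℝ 𝕜 V]

/-- The Lie algebra of `G_U`, as a subspace of the Lie algebra of `G`. -/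
def lieFixer (h : V →ₗ⋆[𝕜] V →ₗ[𝕜] 𝕜) (U : Submodule 𝕜 V) : Submodule ℝ (lieAlg h) where
  carrier := {A | ∀ u ∈ U, A.1 u = 0}
  zero_mem' := fun _ _ => rfl
  add_mem' := by
    intro A C hA hC u hu
    change A.1 u + C.1 u = 0
    rw [hA u hu, hC u hu, add_zero]
  smul_mem' := by
    intro t A hA u hu
    change t • A.1 u = 0
    rw [hA u hu, smul_zero]

theorem lieFixer_maps (h : V →ₗ⋆[𝕜] V →ₗ[𝕜] 𝕜) (U : Submodule 𝕜 V) (A : lieFixer h U) :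
    ∀ x ∈ perp h U, A.1.1 x ∈ perp h U := by
  intro x _ u hu
  have e := A.1.2 u x
  rw [A.2 u hu] at e
  change h u (A.1.1 x) = 0
  simpa using e

/-- The isomorphism `Lie(G_U) → Lie(G(U^⊥))`, the derivative of `fixerToPerp`. -/
def lieFixerToPerp (h : V →ₗ⋆[𝕜] V →ₗ[𝕜] 𝕜) (U : Submodule 𝕜 V) :
    lieFixer h U →ₗ[ℝ] lieAlg (resForm h (perp h U)) where
  toFun A := ⟨A.1.1.restrict (lieFixer_maps h U A), fun x y => A.1.2 (x : V) (y : V)⟩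
  map_add' := fun _ _ => rfl
  map_smul' := fun _ _ => rfl

end Geometry

/-! ### Vector-valued differential forms

`D = G / K`, where `K` is the stabilizer of the base point `o` (`K = U(p) × U(q)` in the unitary
case; in the orthogonal case `K = O(p) × SO(q)` is the stabilizer of the oriented negative subspace
`o`). A differential form on `D` is described by its pull-back along `G → G / K`, written in the
left-invariant trivialization of `TG`: the form `Φ` is the function that sends `g ∈ G` to the
alternating map `(A₁, …, A_N) ↦ Φ_{g·o}(g_* A₁, …, g_* A_N)`, where `g_* A` is the velocity at
`t = 0` of the curve `g exp(tA)·o`. The pull-back is injective, because `G → D` is a submersion.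
The arguments are labelled by a finite type `N`, whose cardinality is the degree. -/

/-- Forms with values in `H`, in the left-invariant trivialization; `Γ` is the group and `𝔩` its Lie
algebra. -/
abbrev Forms (Γ 𝔩 N H : Type*) [AddCommGroup 𝔩] [Module ℝ 𝔩] [AddCommGroup H] [Module ℝ H] :
    Type _ :=
  Γ → (𝔩 [⋀^N]→ₗ[ℝ] H)

/-- The exterior product of a family of complex-valued `ℝ`-linear forms:
`(⋀ α_a)(A) = det (α_a (A_c))`. -/
def wedge {𝔩 N : Type*} [AddCommGroup 𝔩] [Module ℝ 𝔩] [Fintype N] [DecidableEq N]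
    (α : N → (𝔩 →ₗ[ℝ] ℂ)) : 𝔩 [⋀^N]→ₗ[ℝ] ℂ where
  toFun A := (Matrix.of fun c a => α a (A c)).det
  map_update_add' A c x y := by
    have key : ∀ z, (Matrix.of fun c' a => α a (Function.update A c z c')) =
        Matrix.updateRow (Matrix.of fun c' a => α a (A c')) c (fun a => α a z) := by
      intro z
      ext c' a
      by_cases hc : c' = c
      · subst hc; simp
      · simp [hc]
    have e : (fun a => α a (x + y)) = (fun a => α a x) + fun a => α a y := by
      funext a; simp
    convert Matrix.det_updateRow_add (Matrix.of fun c' a => α a (A c')) c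
      (fun a => α a x) (fun a => α a y) using 2
    · rw [← e, ← key]
    · congr 1; rw [← key]
    · rw [← key]; congr!
  map_update_smul' A c t x := by
    have key : ∀ z, (Matrix.of fun c' a => α a (Function.update A c z c')) =
        Matrix.updateRow (Matrix.of fun c' a => α a (A c')) c (fun a => α a z) := by
      intro z
      ext c' a
      by_cases hc : c' = c
      · subst hc; simp
      · simp [hc]
    have e : (fun a => α a (t • x)) = (t : ℂ) • fun a => α a x := by
      funext a; simp
    have k2 := Matrix.det_updateRow_smul (Matrix.of fun c' a => α a (A c')) c
      (t : ℂ) (fun a => α a x)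
    rw [← e, ← key, ← key] at k2
    convert k2 using 1
    · congr!
    · rw [Complex.real_smul]; congr!
  map_eq_zero_of_eq' A c d hcd hne :=
    Matrix.det_zero_of_row_eq hne (by funext a; simp [hcd])

/-- The decomposable form `f ⊗ η` with `f ∈ H` and `η` a complex-valued alternating form. -/
def valued {𝔩 N H : Type*} [AddCommGroup 𝔩] [Module ℝ 𝔩] [AddCommGroup H] [Module ℂ H]
    (f : H) (η : 𝔩 [⋀^N]→ₗ[ℝ] ℂ) : 𝔩 [⋀^N]→ₗ[ℝ] H :=
  ((LinearMap.toSpanSingleton ℂ H f).restrictScalars ℝ).compAlternatingMap η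

/-- The space of functions on `V^S` in which the models of the oscillator representation lie
(`S` is the set of the copies of `V`). -/
abbrev Fun (S V : Type*) : Type _ := (S → V) → ℂ

section Restriction

variable {𝕜 V : Type*} [RCLike 𝕜] [AddCommGroup V] [Module 𝕜 V]
  [Module ℝ V] [SMulCommClass 𝕜 ℝ V] [IsScalarTower ℝ 𝕜 V]

/-- A function on `V^S` as a function on `U^S × (U^⊥)^S` (through `V = U ⊕ U^⊥`). -/
def split (S : Type*) (U W : Submodule 𝕜 V) :
    Fun S V →ₗ[ℝ] ((S → U) × (S → W) → ℂ) where
  toFun f := fun x => f (fun s => (x.1 s : V) + (x.2 s : V))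
  map_add' := fun _ _ => rfl
  map_smul' := fun _ _ => rfl

/-- The restriction map `Ω(D) → Ω(D_U)`, `D_U = G_U / K_U ⊂ D`, on forms with values in the
functions on `V^S`, these being written as functions on `U^S × (U^⊥)^S`. -/
def res (h : V →ₗ⋆[𝕜] V →ₗ[𝕜] 𝕜) (U : Submodule 𝕜 V) {S N : Type*}
    (Φ : Forms (isometries h) (lieAlg h) N (Fun S V)) :
    Forms (fixer h U) (lieFixer h U) N ((S → U) × (S → perp h U) → ℂ) :=
  fun g => (split S U (perp h U)).compAlternatingMap ((Φ g.1).compLinearMap (lieFixer h U).subtype)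

/-- The form `f ⊗ Φ` on `D_U`, for a function `f` on `U^S` and a form `Φ` on the symmetric space of
`U^⊥` (identified with `D_U` by `G_U ≅ G(U^⊥)`) with values in the functions on `(U^⊥)^S`:
its values are the functions `(u, w) ↦ f(u) Φ(w)`. -/
def tensor (h : V →ₗ⋆[𝕜] V →ₗ[𝕜] 𝕜) (U : Submodule 𝕜 V) {S N : Type*} (f : Fun S U)
    (Φ : Forms (isometries (resForm h (perp h U))) (lieAlg (resForm h (perp h U))) N
      (Fun S (perp h U))) :
    Forms (fixer h U) (lieFixer h U) N ((S → U) × (S → perp h U) → ℂ) :=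
  fun g =>
    ({ toFun := fun F x => f x.1 * F x.2
       map_add' := fun F F' => by funext x; simp [mul_add]
       map_smul' := fun t F => by funext x; simp [mul_left_comm] } :
      Fun S (perp h U) →ₗ[ℝ] ((S → U) × (S → perp h U) → ℂ)).compAlternatingMap
      ((Φ (fixerToPerp h U g)).compLinearMap (lieFixerToPerp h U))

/-- Frames of `V` and of `U^⊥` adapted to `U`: the frame `b` of `V` starts with a basis of `U`, and
the other vectors of `b` are the vectors of the frame `b'` of `U^⊥`. In particular both frames
define the same base point `o ∈ D_U ⊂ D`. -/
structure Adapted {l p' q : ℕ} (h : V →ₗ⋆[𝕜] V →ₗ[𝕜] 𝕜) (U : Submodule 𝕜 V)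
    (b : Module.Basis ((Fin l ⊕ Fin p') ⊕ Fin q) 𝕜 V)
    (b' : Module.Basis (Fin p' ⊕ Fin q) 𝕜 (perp h U)) : Prop where
  frame : IsFrame h b
  span : Submodule.span 𝕜 (Set.range fun i : Fin l => b (Sum.inl (Sum.inl i))) = U
  pos : ∀ i, (b' (Sum.inl i) : V) = b (Sum.inl (Sum.inr i))
  neg : ∀ j, (b' (Sum.inr j) : V) = b (Sum.inr j)

end Restriction

/-! ### The orthogonal case: the pair `(Sp(2r), O(p,q))`, Schrödinger model on `V^r` -/

section Orthogonal

variable {V : Type*} [AddCommGroup V] [Module ℝ V] {ι : Type*} [Fintype ι] {q : ℕ}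

/-- The `1`-form `ξ_{i,j}`: the `(i,j)` matrix coefficient of the `Hom(o, o^⊥)` component of `A`. -/
def xiR (h : V →ₗ⋆[ℝ] V →ₗ[ℝ] ℝ) (b : Module.Basis (ι ⊕ Fin q) ℝ V) (i : ι) (j : Fin q) :
    lieAlg h →ₗ[ℝ] ℂ where
  toFun A := ((b.repr (A.1 (b (Sum.inr j))) (Sum.inl i) : ℝ) : ℂ)
  map_add' A C := by simp
  map_smul' t A := by simp

/-- The Gaussian `exp(-π ∑ x_{c,k}²)` on `V^r`, in the coordinates of the frame `b`. -/
def gaussR (b : Module.Basis (ι ⊕ Fin q) ℝ V) (r : ℕ) : Fun (Fin r) V :=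
  fun x => ((Real.exp (-Real.pi * ∑ k, ∑ c, b.repr (x k) c ^ 2) : ℝ) : ℂ)

/-- The operator `½ (x_{i,k} - (1/2π) ∂/∂x_{i,k})`. -/
def createR (b : Module.Basis (ι ⊕ Fin q) ℝ V) {r : ℕ} (k : Fin r) (i : ι)
    (f : Fun (Fin r) V) : Fun (Fin r) V :=
  fun x => (1 / 2 : ℂ) * ((b.repr (x k) (Sum.inl i) : ℝ) * f x
    - (1 / (2 * (Real.pi : ℂ))) * lineDeriv ℝ f x (Pi.single k (b (Sum.inl i))))

/-- The pairs `(k, j)`, in lexicographic order. -/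
def pairs (r q : ℕ) : List (Fin r × Fin q) := List.finRange r ×ˢ List.finRange q

/-- The composite, over the pairs `(k, j)`, of the operators
`½ (x_{I(k,j),k} - (1/2π) ∂/∂x_{I(k,j),k})`, applied to the Gaussian. -/
def coeffR (b : Module.Basis (ι ⊕ Fin q) ℝ V) (r : ℕ) (I : Fin r × Fin q → ι) : Fun (Fin r) V :=
  (pairs r q).foldr (fun a f => createR b a.1 (I a) f) (gaussR b r)

/-- `O(V)` acts in the Schrödinger model by `(ω(g) f)(x) = f(g⁻¹ x)`. -/
def actR (h : V →ₗ⋆[ℝ] V →ₗ[ℝ] ℝ) {r : ℕ} (g : isometries h) (f : Fun (Fin r) V) :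
    Fun (Fin r) V :=
  fun x => f (fun k => (g⁻¹).1 (x k))

/-- The form `φ^{(rq)}` on `D`, of degree `rq`. At the base point it is
`∏_{k,j} ∇_{k,j} · φ₀` with `∇_{k,j} = ∑_i ξ_{i,j} ⊗ ½ (x_{i,k} - (1/2π) ∂/∂x_{i,k})`, written out
as a sum over the choices `I` of one index `i` for each `(k, j)`; its value at `g · o` is obtained
from its value at `o` by the action `ω(g)`. -/
def phiR (h : V →ₗ⋆[ℝ] V →ₗ[ℝ] ℝ) (b : Module.Basis (ι ⊕ Fin q) ℝ V) (r : ℕ) :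
    Forms (isometries h) (lieAlg h) (Fin r × Fin q) (Fun (Fin r) V) :=
  open Classical in
  fun g => ∑ I : Fin r × Fin q → ι,
    valued (actR h g (coeffR b r I)) (wedge fun a => xiR h b (I a) a.2)

/-- The Gaussian `φ₊⁰(u) = exp(-π ∑_k (u_k, u_k))` on `U^r`. -/
def gaussPosR (h : V →ₗ⋆[ℝ] V →ₗ[ℝ] ℝ) (U : Submodule ℝ V) (r : ℕ) : Fun (Fin r) U :=
  fun u => ((Real.exp (-Real.pi * ∑ k, h (u k : V) (u k : V)) : ℝ) : ℂ)

end Orthogonal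

/-! ### The unitary case: the pair `(U(r,s), U(p,q))`, mixed model

With `m = min(r,s)` and `k = |r - s|`, the model consists of functions on `V^m × V^k`: it is the
Schrödinger model in the first `m` variables, and the Fock model in the last `k` variables. In the
Fock model the functions are holomorphic (if `r ≤ s`) or antiholomorphic (if `r > s`) for the
positive complex structure of `V` attached to the base point: multiplication by `i` on `o^⊥` and by
`-i` on `o`. The boolean `c` is `true` when `r > s`, and then everything in the Fock variables is
complex conjugated. -/

section Unitary

variable {V : Type*} [AddCommGroup V] [Module ℂ V] {ι : Type*} [Fintype ι] {q : ℕ}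

/-- Complex conjugation if `c = true`, the identity otherwise. -/
def conjIf (c : Bool) (z : ℂ) : ℂ := if c then conj z else z

/-- The labels of the `1`-form factors: `(k, j, false)` for `\bar ξ_{·,j}` and `(k, j, true)` for
`ξ_{·,j}` in the `k`-th Schrödinger variable, then `(k, j)` in the `k`-th Fock variable. -/
abbrev Lab (m k q : ℕ) : Type := (Fin m × Fin q × Bool) ⊕ (Fin k × Fin q)

/-- The labels in lexicographic order. -/
def labs (m k q : ℕ) : List (Lab m k q) :=
  (List.finRange m ×ˢ (List.finRange q ×ˢ [false, true])).map Sum.inl ++ (pairs k q).map Sum.inr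

/-- The holomorphic `1`-form `ξ_{i,j}`: the `(i,j)` matrix coefficient of the `Hom(o, o^⊥)`
component of `A`. -/
def xiC (h : V →ₗ⋆[ℂ] V →ₗ[ℂ] ℂ) (b : Module.Basis (ι ⊕ Fin q) ℂ V) (i : ι) (j : Fin q) :
    lieAlg h →ₗ[ℝ] ℂ where
  toFun A := b.repr (A.1 (b (Sum.inr j))) (Sum.inl i)
  map_add' A C := by simp
  map_smul' t A := by
    have e : (t • A).1 (b (Sum.inr j)) = (t : ℂ) • A.1 (b (Sum.inr j)) :=
      (Complex.coe_smul t (A.1 (b (Sum.inr j)))).symm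
    rw [e, map_smul, Finsupp.smul_apply, smul_eq_mul, RingHom.id_apply, Complex.real_smul]

/-- The antiholomorphic `1`-form `\bar ξ_{i,j}`. -/
def xiBarC (h : V →ₗ⋆[ℂ] V →ₗ[ℂ] ℂ) (b : Module.Basis (ι ⊕ Fin q) ℂ V) (i : ι) (j : Fin q) :
    lieAlg h →ₗ[ℝ] ℂ :=
  (Complex.conjAe.toLinearMap).comp (xiC h b i j)

/-- The `1`-form with label `a` and positive index `i`. -/
def oneFormC (h : V →ₗ⋆[ℂ] V →ₗ[ℂ] ℂ) (b : Module.Basis (ι ⊕ Fin q) ℂ V) (c : Bool) {m k : ℕ} :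
    Lab m k q → ι → (lieAlg h →ₗ[ℝ] ℂ)
  | Sum.inl (_, j, false), i => xiBarC h b i j
  | Sum.inl (_, j, true), i => xiC h b i j
  | Sum.inr (_, j), i => if c then xiC h b i j else xiBarC h b i j

/-- The derivative `∂/∂X = ½ (∂_v - i ∂_{iv})` of `f` in the direction `v`. -/
def wirt {S : Type*} (f : Fun S V) (x v : S → V) : ℂ :=
  (1 / 2 : ℂ) * (lineDeriv ℝ f x v - Complex.I * lineDeriv ℝ f x (Complex.I • v))

/-- The derivative `∂/∂\bar X = ½ (∂_v + i ∂_{iv})` of `f` in the direction `v`. -/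
def wirtBar {S : Type*} (f : Fun S V) (x v : S → V) : ℂ :=
  (1 / 2 : ℂ) * (lineDeriv ℝ f x v + Complex.I * lineDeriv ℝ f x (Complex.I • v))

/-- The operator with label `a` and positive index `i`: `½ (X_{i,k} - (1/π) ∂/∂\bar X_{i,k})` with
`\bar ξ`, and `½ (\bar X_{i,k} - (1/π) ∂/∂X_{i,k})` with `ξ`, in the Schrödinger variables; and
multiplication by `X_{i,k}` (or by `\bar X_{i,k}` if `c = true`) in the Fock variables. -/
def createC (b : Module.Basis (ι ⊕ Fin q) ℂ V) (c : Bool) {m k : ℕ} :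
    Lab m k q → ι → Fun (Fin m ⊕ Fin k) V → Fun (Fin m ⊕ Fin k) V
  | Sum.inl (a, _, false), i, f => fun x =>
      (1 / 2 : ℂ) * (b.repr (x (Sum.inl a)) (Sum.inl i) * f x
        - (1 / (Real.pi : ℂ)) * wirtBar f x (Pi.single (Sum.inl a) (b (Sum.inl i))))
  | Sum.inl (a, _, true), i, f => fun x =>
      (1 / 2 : ℂ) * (conj (b.repr (x (Sum.inl a)) (Sum.inl i)) * f x
        - (1 / (Real.pi : ℂ)) * wirt f x (Pi.single (Sum.inl a) (b (Sum.inl i))))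
  | Sum.inr (a, _), i, f => fun x =>
      conjIf c (b.repr (x (Sum.inr a)) (Sum.inl i)) * f x

/-- The vacuum vector of the mixed model: the Gaussian `exp(-π ∑ |x_{d,a}|²)` in the Schrödinger
variables and the constant `1` in the Fock variables. -/
def gaussC (b : Module.Basis (ι ⊕ Fin q) ℂ V) (m k : ℕ) : Fun (Fin m ⊕ Fin k) V :=
  fun x => ((Real.exp (-Real.pi * ∑ a : Fin m, ∑ d, ‖b.repr (x (Sum.inl a)) d‖ ^ 2) : ℝ) : ℂ)

/-- The composite of the operators with labels in `labs m k q`, with the choice `I` of the positive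
indices, applied to the vacuum vector. -/
def coeffC (b : Module.Basis (ι ⊕ Fin q) ℂ V) (c : Bool) (m k : ℕ) (I : Lab m k q → ι) :
    Fun (Fin m ⊕ Fin k) V :=
  (labs m k q).foldr (fun a f => createC b c a (I a) f) (gaussC b m k)

/-- The positive definite hermitian form on `V^k` attached to the base point,
`H(v, w) = 2 ∑_a (∑_i \bar v_{i,a} w_{i,a} + ∑_j v_{j,a} \bar w_{j,a})`. It is complex linear in `w`
for the complex structure attached to the base point, and its imaginary part is the symplectic form
`2 ∑_a Im h(v_a, w_a)`. -/
def fockForm (b : Module.Basis (ι ⊕ Fin q) ℂ V) {k : ℕ} (v w : Fin k → V) : ℂ :=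
  2 * ∑ a, (∑ i : ι, conj (b.repr (v a) (Sum.inl i)) * b.repr (w a) (Sum.inl i)
    + ∑ j : Fin q, b.repr (v a) (Sum.inr j) * conj (b.repr (w a) (Sum.inr j)))

/-- The vector of `V^k` with the given coordinates in the frame `b`. -/
def ofCoord (b : Module.Basis (ι ⊕ Fin q) ℂ V) {k : ℕ} (y : Fin k → ι ⊕ Fin q → ℂ) : Fin k → V :=
  fun a => b.equivFun.symm (y a)

/-- The determinant of the `o`-`o` block of `g`. -/
def detNeg (h : V →ₗ⋆[ℂ] V →ₗ[ℂ] ℂ) (b : Module.Basis (ι ⊕ Fin q) ℂ V) (g : isometries h) : ℂ :=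
  (Matrix.of fun j j' : Fin q => b.repr (g.1 (b (Sum.inr j'))) (Sum.inr j)).det

/-- The oscillator representation `ω` of `U(V)` in the mixed model on `V^m × V^k`. The action on the
Schrödinger variables is `x ↦ g⁻¹ x`. On the Fock variables, a function `F` stands for the element
`F e^{-(π/2) H(w,w)}` of `L²(V^k)`; it is translated by `g`, projected orthogonally back onto the Fock
space by the reproducing kernel `e^{π H(w',w)}`, and multiplied by `det(g|_{o → o})^k`, with the
Lebesgue measure `dw'` normalized by `∫ e^{-π H(w',w')} dw' = 1`:
`(ω(g) F)(w) = det(g|_{o → o})^k ∫ F(g⁻¹w') e^{-(π/2)(H(g⁻¹w',g⁻¹w') + H(w',w'))} e^{π H(w',w)} dw'`.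
The elements `k = (k₁, k₂)` of the maximal compact subgroup `U(p) × U(q)` then act by
`(ω(k) F)(w) = det(k₂)^k F(k⁻¹ w)`. If `c = true` one takes the complex conjugate representation in
the Fock variables. -/
def actC (h : V →ₗ⋆[ℂ] V →ₗ[ℂ] ℂ) (b : Module.Basis (ι ⊕ Fin q) ℂ V) (c : Bool) {m k : ℕ}
    (g : isometries h) (f : Fun (Fin m ⊕ Fin k) V) : Fun (Fin m ⊕ Fin k) V :=
  fun x =>
    conjIf c (detNeg h b g) ^ k *
    (∫ y : Fin k → ι ⊕ Fin q → ℂ,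
      Complex.exp (-(Real.pi : ℂ) * fockForm b (ofCoord b y) (ofCoord b y)))⁻¹ *
    ∫ y : Fin k → ι ⊕ Fin q → ℂ,
      f (Sum.elim (fun a => (g⁻¹).1 (x (Sum.inl a))) (fun a => (g⁻¹).1 (ofCoord b y a))) *
      Complex.exp (-((Real.pi : ℂ) / 2) *
        (fockForm b (fun a => (g⁻¹).1 (ofCoord b y a)) (fun a => (g⁻¹).1 (ofCoord b y a))
          + fockForm b (ofCoord b y) (ofCoord b y))) *
      Complex.exp ((Real.pi : ℂ) *
        conjIf c (fockForm b (ofCoord b y) (fun a => x (Sum.inr a))))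

/-- The form `φ_1 ∧ … ∧ φ_m ∧ ψ_{m+1} ∧ … ∧ ψ_{m+k}` on `D`, where
`φ_a = ∏_j ∇_{a,j} \bar∇_{a,j} · φ₀`, `∇_{a,j} = ∑_i \bar ξ_{i,j} ⊗ ½ (X_{i,a} - (1/π) ∂/∂\bar X_{i,a})`,
and `ψ_a = ∑_{i_1, …, i_q} X_{i_1,a} ⋯ X_{i_q,a} \bar ξ_{i_1,1} ∧ … ∧ \bar ξ_{i_q,q}` (or the complex
conjugate of this, if `c = true`). It is written out at the base point as a sum over the choices `I`
of one positive index for each label; its value at `g · o` is obtained from its value at `o` by the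
action `ω(g)`. -/
def mixedForm (h : V →ₗ⋆[ℂ] V →ₗ[ℂ] ℂ) (b : Module.Basis (ι ⊕ Fin q) ℂ V) (c : Bool) (m k : ℕ) :
    Forms (isometries h) (lieAlg h) (Lab m k q) (Fun (Fin m ⊕ Fin k) V) :=
  open Classical in
  fun g => ∑ I : Lab m k q → ι,
    valued (actC h b c g (coeffC b c m k I)) (wedge fun a => oneFormC h b c a (I a))

/-- The number of Schrödinger variables for the pair `(U(r,s), U(p,q))`. -/
abbrev nS (r s : ℕ) : ℕ := min r s

/-- The number `|r - s|` of Fock variables for the pair `(U(r,s), U(p,q))`. -/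
abbrev nF (r s : ℕ) : ℕ := max r s - min r s

/-- The form `φ^{(rq,sq)}` on `D`, of type `(rq, sq)`, hence of degree `(r+s)q`. -/
def phiC (h : V →ₗ⋆[ℂ] V →ₗ[ℂ] ℂ) (b : Module.Basis (ι ⊕ Fin q) ℂ V) (r s : ℕ) :
    Forms (isometries h) (lieAlg h) (Lab (nS r s) (nF r s) q)
      (Fun (Fin (nS r s) ⊕ Fin (nF r s)) V) :=
  mixedForm h b (decide (s < r)) (nS r s) (nF r s)

/-- The Gaussian `φ₊⁰` of `U`: the vacuum vector `exp(-π ∑_a (u_a, u_a))`, the sum being over the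
Schrödinger variables, which is constant in the Fock variables. -/
def gaussPosC (h : V →ₗ⋆[ℂ] V →ₗ[ℂ] ℂ) (U : Submodule ℂ V) (r s : ℕ) :
    Fun (Fin (nS r s) ⊕ Fin (nF r s)) U :=
  fun u => Complex.exp (-(Real.pi : ℂ) * ∑ a : Fin (nS r s), h (u (Sum.inl a) : V) (u (Sum.inl a) : V))

end Unitary

end Seesaw

end

noncomputable section

open scoped ComplexConjugate InnerProductSpace

namespace Seesaw


/-! ### Orthonormal frames, the law of inertia, and existence of adapted frames. -/

section Frames

variable {𝕜 V : Type*} [RCLike 𝕜] [AddCommGroup V] [Module 𝕜 V]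
  {h : V →ₗ⋆[𝕜] V →ₗ[𝕜] 𝕜} {ι κ ι' κ' : Type*}

/-! Forms are compared at `g` in `G_U` on vectors `A` of its Lie algebra. Such an `A` preserves
`U^⊥`, which contains `o`; hence the `ξ_{i,j}` with `i ≤ l` restrict to zero and the others to the
forms of the same name for `U^⊥` (`Adapted.repr_lieFixer`). Expanding the product over choices `I`
of positive indices, only the choices avoiding `U` survive.

For these, the operators differentiate and multiply along `U^⊥` only. The Gaussian splits as
(Gaussian of `U`) times (Gaussian of `U^⊥`), and its first factor is a constant for every operator
(`Adapted.coeffR_add`, `Adapted.coeffC_add`).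

It remains to apply `ω(g)`. In Schrödinger variables `g⁻¹(u + w) = u + g⁻¹w`, and nothing else is
needed. In Fock variables `ω(g)` is an integral against a Gaussian kernel; it factors along `V = U ⊕
U^⊥`. As `g` fixes `U` and the function is constant in the Fock variables of `U`, the `U`-factor is
the reproducing property for a constant: independent of `u`, it cancels the `U`-part of the
normalization (`integral_fock_pi`, `Adapted.actC_add`).

Adapted frames exist by diagonalizing `h` on `U` and on `U^⊥`; the law of inertia gives the sizes.
-/

theorem IsFrame.apply_eq [Fintype ι] [Fintype κ] {b : Module.Basis (ι ⊕ κ) 𝕜 V}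
    (hb : IsFrame h b) (x y : V) :
    h x y = ∑ i, conj (b.repr x (Sum.inl i)) * b.repr y (Sum.inl i)
      - ∑ j, conj (b.repr x (Sum.inr j)) * b.repr y (Sum.inr j) := by
  classical
  obtain ⟨h1, h2, h3⟩ := hb
  have key : ∀ c, h (b c) y = b.repr y c * h (b c) (b c) := by
    intro c
    conv_lhs => rw [← b.sum_repr y]
    rw [map_sum, Finset.sum_eq_single c]
    · simp
    · intro d _ hd
      simp [h3 c d hd.symm]
    · simp
  conv_lhs => rw [← b.sum_repr x]
  simp only [map_sum, LinearMap.sum_apply, map_smulₛₗ, LinearMap.smul_apply, smul_eq_mul, key]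
  rw [Fintype.sum_sum_type]
  simp only [h1, h2]
  simp [sub_eq_add_neg]

theorem IsFrame.conj_apply [Fintype ι] [Fintype κ] {b : Module.Basis (ι ⊕ κ) 𝕜 V}
    (hb : IsFrame h b) (x y : V) : conj (h x y) = h y x := by
  rw [hb.apply_eq, hb.apply_eq]
  simp [mul_comm]

theorem IsFrame.eq_zero [Fintype ι] [Fintype κ] {b : Module.Basis (ι ⊕ κ) 𝕜 V}
    (hb : IsFrame h b) (x : V) (hx : ∀ y, h y x = 0) : x = 0 := by
  classical
  apply b.repr.injective
  ext c
  have e := hx (b c)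
  rw [hb.apply_eq] at e
  rcases c with i | j
  · simpa [Finsupp.single_apply] using e
  · simpa [Finsupp.single_apply] using e

theorem IsFrame.apply_self_re [Fintype ι] [Fintype κ] {b : Module.Basis (ι ⊕ κ) 𝕜 V}
    (hb : IsFrame h b) (x : V) :
    RCLike.re (h x x) = ∑ i, ‖b.repr x (Sum.inl i)‖ ^ 2 - ∑ j, ‖b.repr x (Sum.inr j)‖ ^ 2 := by
  rw [hb.apply_eq]
  simp only [RCLike.conj_mul, map_sub, map_sum]
  norm_cast

/-- One half of Sylvester's law of inertia. -/
theorem IsFrame.card_neg_le [Fintype ι] [Fintype κ] [Fintype ι'] [Fintype κ']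
    {b : Module.Basis (ι ⊕ κ) 𝕜 V} {b' : Module.Basis (ι' ⊕ κ') 𝕜 V}
    (hb : IsFrame h b) (hb' : IsFrame h b') : Fintype.card κ ≤ Fintype.card κ' := by
  classical
  -- `f` takes the negative `b'`-coordinates of a vector in the negative span of `b`. On its kernel
  -- `h x x` is `≤ 0` by `b` and `≥ 0` by `b'`, so `x = 0`.
  let f : (κ → 𝕜) →ₗ[𝕜] (κ' → 𝕜) :=
    (LinearMap.pi fun j => b'.coord (Sum.inr j)) ∘ₗ
      (Fintype.linearCombination 𝕜 fun k => b (Sum.inr k))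
  have hf : Function.Injective f := by
    rw [← LinearMap.ker_eq_bot, LinearMap.ker_eq_bot']
    intro m hm
    set x := Fintype.linearCombination 𝕜 (fun k => b (Sum.inr k)) m with hx
    have c1 : ∀ i, b.repr x (Sum.inl i) = 0 := by
      intro i
      simp [hx, Fintype.linearCombination_apply]
    have c2 : ∀ k, b.repr x (Sum.inr k) = m k := by
      intro i
      simp [hx, Fintype.linearCombination_apply, Finsupp.single_apply]
    have c3 : ∀ j, b'.repr x (Sum.inr j) = 0 := fun j => congrFun hm j
    have e1 := hb.apply_self_re x
    have e2 := hb'.apply_self_re x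
    simp only [c1, c2, c3, norm_zero] at e1 e2
    have e3 : 0 ≤ ∑ i, ‖b'.repr x (Sum.inl i)‖ ^ 2 := by positivity
    have e4 : ∑ k, ‖m k‖ ^ 2 = 0 := by
      apply le_antisymm _ (by positivity)
      simp at e1 e2
      linarith
    funext k
    have := (Finset.sum_eq_zero_iff_of_nonneg (fun i _ => by positivity)).1 e4 k (Finset.mem_univ _)
    simpa using this
  simpa using LinearMap.finrank_le_finrank_of_injective hf

/-- A nondegenerate hermitian form on a finite-dimensional space has an orthonormal frame. -/
theorem exists_isFrame [FiniteDimensional 𝕜 V] (hh : ∀ x y, conj (h x y) = h y x)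
    (hnd : ∀ x, (∀ y, h y x = 0) → x = 0) : ∃ p q : ℕ, HasSignature h p q := by
  classical
  set n := Module.finrank 𝕜 V with hn
  let φ : EuclideanSpace 𝕜 (Fin n) ≃ₗ[𝕜] V :=
    LinearEquiv.ofFinrankEq _ _ (by simp [hn])
  let e := EuclideanSpace.basisFun (Fin n) 𝕜
  -- `T` represents `h` against an auxiliary Euclidean inner product; the spectral theorem for `T`
  -- diagonalizes `h`.
  let T : EuclideanSpace 𝕜 (Fin n) →ₗ[𝕜] EuclideanSpace 𝕜 (Fin n) :=
    ∑ i, ((h (φ (e i))) ∘ₗ φ.toLinearMap).smulRight (e i)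
  have hT : ∀ x y, ⟪x, T y⟫_𝕜 = h (φ x) (φ y) := by
    intro x y
    conv_rhs => rw [← e.sum_repr' x]
    simp [T, inner_sum, inner_smul_right, LinearMap.sum_apply, mul_comm]
  have hsym : T.IsSymmetric := by
    intro x y
    rw [← inner_conj_symm, hT, hT, hh]
  let v := hsym.eigenvectorBasis (n := n) (by simp)
  let lam := hsym.eigenvalues (n := n) (by simp)
  have hv : ∀ i j, h (φ (v i)) (φ (v j)) = if i = j then (lam i : 𝕜) else 0 := by
    intro i j
    rw [← hT, hsym.apply_eigenvectorBasis, inner_smul_right,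
      orthonormal_iff_ite.1 v.orthonormal i j]
    split_ifs with hij
    · subst hij; simp [lam]
    · simp
  have hlam : ∀ i, lam i ≠ 0 := by
    intro i hi
    have h0 : φ (v i) = 0 := by
      apply hnd
      intro y
      obtain ⟨x, rfl⟩ := φ.surjective y
      rw [← v.sum_repr' x]
      simp only [map_sum, LinearMap.sum_apply, map_smulₛₗ, LinearMap.smul_apply, hv]
      simp [hi]
    exact v.toBasis.ne_zero i (by simpa using h0)
  -- Rescaling by `|λ|^{-1/2}` turns the square `λ` into its sign.
  let w : Fin n → 𝕜 := fun i => (((Real.sqrt |lam i|)⁻¹ : ℝ) : 𝕜)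
  have hw : ∀ i, IsUnit (w i) := by
    intro i
    have : (Real.sqrt |lam i|)⁻¹ ≠ 0 := by
      have := abs_pos.2 (hlam i)
      positivity
    exact isUnit_iff_ne_zero.2 (by simpa [w] using hlam i)
  let B := (v.toBasis.map φ).isUnitSMul hw
  have hB : ∀ i j, h (B i) (B j) = if i = j then ((lam i / |lam i| : ℝ) : 𝕜) else 0 := by
    intro i j
    have e1 : ∀ i, B i = w i • φ (v i) := fun i => by
      simp [B, Module.Basis.isUnitSMul_apply]
    rw [e1, e1, map_smul, map_smulₛₗ, LinearMap.smul_apply, hv]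
    split_ifs with hij
    · subst hij
      simp only [w, RCLike.conj_ofReal, smul_eq_mul]
      norm_cast
      have : 0 < |lam i| := abs_pos.2 (hlam i)
      have h2 : Real.sqrt |lam i| ^ 2 = |lam i| := Real.sq_sqrt this.le
      have h3 : Real.sqrt |lam i| ≠ 0 := (Real.sqrt_pos.2 this).ne'
      rw [eq_div_iff this.ne']
      conv_lhs => rw [← h2]
      field_simp
      rw [h2, h2]
    · simp
  let E : Fin n ≃ Fin (Fintype.card {i // 0 < lam i}) ⊕ Fin (Fintype.card {i // ¬ 0 < lam i}) :=
    (Equiv.sumCompl fun i => 0 < lam i).symm.trans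
      (Equiv.sumCongr (Fintype.equivFin _) (Fintype.equivFin _))
  refine ⟨_, _, B.reindex E, ?_, ?_, ?_⟩
  · intro i
    rw [Module.Basis.reindex_apply, hB, if_pos rfl]
    have : 0 < lam (E.symm (Sum.inl i)) := by
      simpa [E] using ((Fintype.equivFin {i // 0 < lam i}).symm i).2
    rw [abs_of_pos this, div_self this.ne', RCLike.ofReal_one]
  · intro j
    rw [Module.Basis.reindex_apply, hB, if_pos rfl]
    have h1 : ¬ 0 < lam (E.symm (Sum.inr j)) :=
      ((Fintype.equivFin {i // ¬ 0 < lam i}).symm j).2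
    have : lam (E.symm (Sum.inr j)) < 0 := lt_of_le_of_ne (not_lt.1 h1) (hlam _)
    rw [abs_of_neg this, div_neg, div_self this.ne, RCLike.ofReal_neg, RCLike.ofReal_one]
  · intro c d hcd
    rw [Module.Basis.reindex_apply, Module.Basis.reindex_apply, hB, if_neg]
    simpa using hcd

/-- A positive definite subspace has an orthonormal basis. -/
theorem IsPosDefOn.exists_orthonormal_basis [FiniteDimensional 𝕜 V] {U : Submodule 𝕜 V}
    (hU : IsPosDefOn h U) (hh : ∀ x y, conj (h x y) = h y x) {l : ℕ}
    (hl : Module.finrank 𝕜 U = l) :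
    ∃ e : Module.Basis (Fin l) 𝕜 U,
      (∀ i, h (e i : V) (e i) = 1) ∧ ∀ i j, i ≠ j → h (e i : V) (e j) = 0 := by
  obtain ⟨p, q, b, hb⟩ := exists_isFrame (h := resForm h U) (fun x y => hh x y) (by
    intro x hx
    by_contra hne
    have h1 := hU x x.2 (by simpa using hne)
    have h2 : h (x : V) x = 0 := hx x
    rw [h2] at h1
    simp at h1)
  have hq : IsEmpty (Fin q) := by
    constructor
    intro j
    have h1 := hU _ (b (Sum.inr j)).2 (by simpa using b.ne_zero (Sum.inr j))
    have h2 : h (b (Sum.inr j) : V) (b (Sum.inr j)) = -1 := hb.2.1 j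
    rw [h2] at h1
    simp at h1
    linarith
  have hp : p = l := by
    rw [← hl, Module.finrank_eq_card_basis b]
    simp
  subst hp
  refine ⟨b.reindex (Equiv.sumEmpty _ _), fun i => ?_, fun i j hij => ?_⟩
  · rw [Module.Basis.reindex_apply]
    exact hb.1 i
  · rw [Module.Basis.reindex_apply, Module.Basis.reindex_apply]
    exact hb.2.2 (Sum.inl i) (Sum.inl j) (by simpa using hij)

/-- Every positive definite subspace has adapted frames. -/
theorem exists_adapted {p q l : ℕ} {U : Submodule 𝕜 V} (hsig : HasSignature h p q)
    (hU : IsPosDefOn h U) (hl : Module.finrank 𝕜 U = l) :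
    ∃ (b : Module.Basis ((Fin l ⊕ Fin (p - l)) ⊕ Fin q) 𝕜 V)
      (b' : Module.Basis (Fin (p - l) ⊕ Fin q) 𝕜 (perp h U)), Adapted h U b b' := by
  classical
  obtain ⟨b₀, hb₀⟩ := hsig
  have hfd : FiniteDimensional 𝕜 V := b₀.finiteDimensional_of_finite
  have hh := hb₀.conj_apply
  obtain ⟨e, he1, he2⟩ := hU.exists_orthonormal_basis hh hl
  have hcompl : IsCompl U (perp h U) := by
    constructor
    · rw [Submodule.disjoint_def]
      intro x hx hx'
      by_contra hne
      have h1 := hU x hx hne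
      have h2 : h x x = 0 := hx' x hx
      rw [h2] at h1
      simp at h1
    · rw [codisjoint_iff, eq_top_iff]
      intro x _
      rw [Submodule.mem_sup]
      -- The orthogonal projection of `x` to `U`.
      refine ⟨((∑ i, h (e i : V) x • e i : U) : V), Subtype.prop _,
        x - ((∑ i, h (e i : V) x • e i : U) : V), ?_, by abel⟩
      have key : ∀ j, h (e j : V) (x - ((∑ i, h (e i : V) x • e i : U) : V)) = 0 := by
        intro j
        simp only [Submodule.coe_sum, Submodule.coe_smul, map_sub, map_sum, map_smul]
        rw [Finset.sum_eq_single j]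
        · simp [he1]
        · intro i _ hij
          simp [he2 j i hij.symm]
        · simp
      intro u hu
      change h u _ = 0
      have : u = ((∑ i, e.repr ⟨u, hu⟩ i • e i : U) : V) := by rw [e.sum_repr]
      rw [this]
      simp only [Submodule.coe_sum, Submodule.coe_smul, map_sum, LinearMap.sum_apply, map_smulₛₗ,
        LinearMap.smul_apply] at key ⊢
      simp [key]
  obtain ⟨a, c, b', hb'⟩ := exists_isFrame (h := resForm h (perp h U)) (fun x y => hh x y) (by
    intro w hw
    have : (w : V) = 0 := by
      apply hb₀.eq_zero
      intro y
      have hy : y ∈ U ⊔ perp h U := by rw [hcompl.sup_eq_top]; trivial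
      obtain ⟨u, hu, z, hz, rfl⟩ := Submodule.mem_sup.1 hy
      have h1 : h u (w : V) = 0 := w.2 u hu
      have h2 : h z (w : V) = 0 := hw ⟨z, hz⟩
      simp [h1, h2]
    simpa using this)
  let B : Module.Basis ((Fin l ⊕ Fin a) ⊕ Fin c) 𝕜 V :=
    ((e.prod b').map (Submodule.prodEquivOfIsCompl U (perp h U) hcompl)).reindex
      (Equiv.sumAssoc _ _ _).symm
  have B1 : ∀ i, B (Sum.inl (Sum.inl i)) = e i := fun i => by simp [B]
  have B2 : ∀ i, B (Sum.inl (Sum.inr i)) = b' (Sum.inl i) := fun i => by simp [B]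
  have B3 : ∀ i, B (Sum.inr i) = b' (Sum.inr i) := fun i => by simp [B]
  have o1 : ∀ i d, h (e i : V) (b' d : V) = 0 := fun i d => (b' d).2 _ (e i).2
  have o2 : ∀ i d, h (b' d : V) (e i : V) = 0 := fun i d => by
    rw [← hh, o1, map_zero]
  have hB : IsFrame h B := by
    refine ⟨?_, ?_, ?_⟩
    · rintro (i | i)
      · rw [B1, he1]
      · rw [B2]; exact hb'.1 i
    · intro j
      rw [B3]; exact hb'.2.1 j
    · have o3 : ∀ c d, c ≠ d → h (b' c : V) (b' d) = 0 := hb'.2.2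
      rintro ((i | i) | i) ((j | j) | j) hij <;> simp only [B1, B2, B3, o1, o2]
      · exact he2 _ _ (by simpa using hij)
      all_goals exact o3 _ _ (by simpa using hij)
  have hc : c = q := by
    apply le_antisymm
    · simpa using hB.card_neg_le hb₀
    · simpa using hb₀.card_neg_le hB
  -- The dimension count gives `l + a = p`, so the subtraction is not truncated.
  have ha : a = p - l := by
    have h1 := Module.finrank_eq_card_basis B
    rw [Module.finrank_eq_card_basis b₀] at h1
    simp at h1
    omega
  subst hc ha
  refine ⟨B, b', hB, ?_, fun i => (B2 i).symm, fun i => (B3 i).symm⟩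
  simp only [B1]
  have := congrArg (Submodule.map U.subtype) e.span_eq
  rw [Submodule.map_span, ← Set.range_comp, Submodule.map_top, Submodule.range_subtype] at this
  exact this

end Frames


/-! ### Coordinates of `u + w`, of `G_U` and of its Lie algebra in adapted frames. -/

section Coordinates

variable {𝕜 V : Type*} [RCLike 𝕜] [AddCommGroup V] [Module 𝕜 V]
  {h : V →ₗ⋆[𝕜] V →ₗ[𝕜] 𝕜} {U : Submodule 𝕜 V} {l p' q : ℕ}
  {b : Module.Basis ((Fin l ⊕ Fin p') ⊕ Fin q) 𝕜 V}
  {b' : Module.Basis (Fin p' ⊕ Fin q) 𝕜 (perp h U)}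

namespace Adapted

theorem mem (hA : Adapted h U b b') (i : Fin l) : b (Sum.inl (Sum.inl i)) ∈ U := by
  rw [← hA.span]
  exact Submodule.subset_span ⟨i, rfl⟩

theorem repr_eq_zero (hA : Adapted h U b b') {u : V} (hu : u ∈ U) {c : (Fin l ⊕ Fin p') ⊕ Fin q}
    (hc : ∀ i, Sum.inl (Sum.inl i) ≠ c) : b.repr u c = 0 := by
  rw [← hA.span] at hu
  have : Submodule.span 𝕜 (Set.range fun i : Fin l => b (Sum.inl (Sum.inl i))) ≤
      LinearMap.ker (b.coord c) := by
    rw [Submodule.span_le]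
    rintro _ ⟨i, rfl⟩
    simp [hc]
  exact this hu

theorem repr_pos (hA : Adapted h U b b') (u : U) (i : Fin p') :
    b.repr (u : V) (Sum.inl (Sum.inr i)) = 0 := hA.repr_eq_zero u.2 (by simp)

theorem repr_neg (hA : Adapted h U b b') (u : U) (j : Fin q) :
    b.repr (u : V) (Sum.inr j) = 0 := hA.repr_eq_zero u.2 (by simp)

theorem repr_perp (hA : Adapted h U b b') (w : perp h U) :
    (∀ i, b.repr (w : V) (Sum.inl (Sum.inl i)) = 0) ∧
    (∀ i, b.repr (w : V) (Sum.inl (Sum.inr i)) = b'.repr w (Sum.inl i)) ∧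
    ∀ j, b.repr (w : V) (Sum.inr j) = b'.repr w (Sum.inr j) := by
  classical
  refine ⟨fun i => ?_, fun i => ?_, fun i => ?_⟩
  · have : b.coord (Sum.inl (Sum.inl i)) ∘ₗ (perp h U).subtype = 0 := by
      apply b'.ext
      rintro (j | j) <;> simp [hA.pos, hA.neg]
    exact LinearMap.congr_fun this w
  · have : b.coord (Sum.inl (Sum.inr i)) ∘ₗ (perp h U).subtype = b'.coord (Sum.inl i) := by
      apply b'.ext
      rintro (j | j) <;> simp [hA.pos, hA.neg, Finsupp.single_apply]
    exact LinearMap.congr_fun this w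
  · have : b.coord (Sum.inr i) ∘ₗ (perp h U).subtype = b'.coord (Sum.inr i) := by
      apply b'.ext
      rintro (j | j) <;> simp [hA.pos, hA.neg, Finsupp.single_apply]
    exact LinearMap.congr_fun this w

theorem repr_add_inl (hA : Adapted h U b b') (u : U) (w : perp h U) (i : Fin l) :
    b.repr ((u : V) + w) (Sum.inl (Sum.inl i)) = b.repr (u : V) (Sum.inl (Sum.inl i)) := by
  simp [(hA.repr_perp w).1]

theorem repr_add_pos (hA : Adapted h U b b') (u : U) (w : perp h U) (i : Fin p') :
    b.repr ((u : V) + w) (Sum.inl (Sum.inr i)) = b'.repr w (Sum.inl i) := by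
  simp [(hA.repr_perp w).2.1, hA.repr_pos]

theorem repr_add_neg (hA : Adapted h U b b') (u : U) (w : perp h U) (j : Fin q) :
    b.repr ((u : V) + w) (Sum.inr j) = b'.repr w (Sum.inr j) := by
  simp [(hA.repr_perp w).2.2, hA.repr_neg]

theorem apply_self (hA : Adapted h U b b') (u : U) :
    h (u : V) u = ((∑ i, ‖b.repr (u : V) (Sum.inl (Sum.inl i))‖ ^ 2 : ℝ) : 𝕜) := by
  rw [hA.frame.apply_eq]
  simp [Fintype.sum_sum_type, hA.repr_pos, hA.repr_neg, RCLike.conj_mul]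

end Adapted

/-- The inverse of `g` also fixes `U` pointwise, so the action moves only `w`. -/
theorem fixer_inv_add (g : fixer h U) (u : U) (w : perp h U) :
    (g.1⁻¹).1 ((u : V) + w) = (u : V) + (((fixerToPerp h U g)⁻¹).1 w : perp h U) := by
  rw [map_add]
  congr 1
  exact (g⁻¹).2 u u.2

/-- The vector `b (Sum.inr j)` lies in `U^⊥`, which `A` preserves. This determines the restriction
of every `ξ_{i,j}` to `D_U`. -/
theorem Adapted.repr_lieFixer [Module ℝ V] [SMulCommClass 𝕜 ℝ V] [IsScalarTower ℝ 𝕜 V]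
    (hA : Adapted h U b b') (A : lieFixer h U) (j : Fin q) :
    (∀ i, b.repr (A.1.1 (b (Sum.inr j))) (Sum.inl (Sum.inl i)) = 0) ∧
    ∀ i, b.repr (A.1.1 (b (Sum.inr j))) (Sum.inl (Sum.inr i)) =
      b'.repr ((lieFixerToPerp h U A).1 (b' (Sum.inr j))) (Sum.inl i) := by
  rw [← hA.neg]
  have hx := hA.repr_perp ((lieFixerToPerp h U A).1 (b' (Sum.inr j)))
  exact ⟨hx.1, hx.2.1⟩

theorem wedge_eq_zero {𝔩 N : Type*} [AddCommGroup 𝔩] [Module ℝ 𝔩] [Fintype N] [DecidableEq N]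
    (α : N → (𝔩 →ₗ[ℝ] ℂ)) (A : N → 𝔩) (a : N) (ha : ∀ c, α a (A c) = 0) : wedge α A = 0 :=
  Matrix.det_eq_zero_of_column_eq_zero a ha

/-- Singles out the choices of indices that meet `U`; `wedge_eq_zero` then kills their terms. -/
theorem exists_eq_inl_of_notMem_range {N α β : Type*} {I : N → α ⊕ β}
    (hI : I ∉ Set.range fun (J : N → β) a => (Sum.inr (J a) : α ⊕ β)) :
    ∃ a i, I a = Sum.inl i := by
  by_contra! hcon
  apply hI
  have : ∀ a, ∃ i, Sum.inr i = I a := fun a => by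
    rcases hIa : I a with i | i
    · exact absurd hIa (hcon a i)
    · exact ⟨i, rfl⟩
  choose J hJ using this
  exact ⟨J, funext hJ⟩

theorem sum_valued_apply {𝔩 N X J : Type*} [AddCommGroup 𝔩] [Module ℝ 𝔩] (s : Finset J)
    (f : J → X → ℂ) (η : J → 𝔩 [⋀^N]→ₗ[ℝ] ℂ) (A : N → 𝔩) (x : X) :
    (∑ i ∈ s, valued (f i) (η i)) A x = ∑ i ∈ s, η i A * f i x := by
  classical
  induction s using Finset.induction_on with
  | empty => rfl
  | insert i s hi ih =>
    rw [Finset.sum_insert hi, Finset.sum_insert hi, ← ih]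
    rfl

/-- Differentiability is not needed: a scalar of a field comes out of `deriv` even where `deriv`
takes its default value `0`. -/
theorem lineDeriv_const_mul_comp {E F : Type*} [AddCommGroup E] [Module ℝ E] [AddCommGroup F]
    [Module ℝ F] {f : E → ℂ} {f' : F → ℂ} {x v : E} {y z : F} (γ : ℂ)
    (hf : ∀ t : ℝ, f (x + t • v) = γ * f' (y + t • z)) :
    lineDeriv ℝ f x v = γ * lineDeriv ℝ f' y z := by
  simp only [lineDeriv, hf]
  exact deriv_const_mul_field γ

end Coordinates

/-! ### Restriction in the orthogonal case. -/

section Orthogonal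

variable {V : Type*} [AddCommGroup V] [Module ℝ V]
  {h : V →ₗ⋆[ℝ] V →ₗ[ℝ] ℝ} {U : Submodule ℝ V} {l p' q : ℕ}
  {b : Module.Basis ((Fin l ⊕ Fin p') ⊕ Fin q) ℝ V}
  {b' : Module.Basis (Fin p' ⊕ Fin q) ℝ (perp h U)}

theorem Adapted.gaussR_add (hA : Adapted h U b b') (r : ℕ) (u : Fin r → U) (w : Fin r → perp h U) :
    gaussR b r (fun k => (u k : V) + w k) = gaussPosR h U r u * gaussR b' r w := by
  simp only [gaussR, gaussPosR, Fintype.sum_sum_type, hA.repr_add_inl, hA.repr_add_pos,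
    hA.repr_add_neg, hA.apply_self]
  rw [← Complex.ofReal_mul, ← Real.exp_add]
  congr 2
  simp only [Finset.sum_add_distrib, Real.norm_eq_abs, sq_abs]
  simp
  ring

/-- The direction of differentiation lies in `U^⊥`, so `u` is a frozen parameter and `γ` a constant.
-/
theorem Adapted.createR_add (hA : Adapted h U b b') {r : ℕ} (k : Fin r) (i : Fin p')
    {f : Fun (Fin r) V} {f' : Fun (Fin r) (perp h U)} {γ : ℂ} {u : Fin r → U}
    (hf : ∀ w : Fin r → perp h U, f (fun k => (u k : V) + w k) = γ * f' w)
    (w : Fin r → perp h U) :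
    createR b k (Sum.inr i) f (fun k => (u k : V) + w k) = γ * createR b' k i f' w := by
  have key : lineDeriv ℝ f (fun k => (u k : V) + w k) (Pi.single k (b (Sum.inl (Sum.inr i)))) =
      γ * lineDeriv ℝ f' w (Pi.single k (b' (Sum.inl i))) := by
    apply lineDeriv_const_mul_comp
    intro t
    rw [← hf]
    congr 1
    funext a
    by_cases ha : a = k
    · subst ha; simp [hA.pos, add_assoc]
    · simp [ha]
  simp only [createR, key, hf, hA.repr_add_pos]
  ring

theorem Adapted.coeffR_add (hA : Adapted h U b b') (r : ℕ) (I : Fin r × Fin q → Fin p')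
    (u : Fin r → U) (w : Fin r → perp h U) :
    coeffR b r (fun a => Sum.inr (I a)) (fun k => (u k : V) + w k) =
      gaussPosR h U r u * coeffR b' r I w := by
  -- The induction must keep `w` arbitrary, since the next operator differentiates in `w`.
  unfold coeffR
  induction pairs r q generalizing w with
  | nil => exact hA.gaussR_add r u w
  | cons a L ih => exact hA.createR_add a.1 (I a) ih w

theorem Adapted.res_phiR (hA : Adapted h U b b') (r : ℕ) :
    res h U (phiR h b r) = tensor h U (gaussPosR h U r) (phiR (resForm h (perp h U)) b' r) := by
  classical
  funext g
  ext A x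
  obtain ⟨u, w⟩ := x
  change (phiR h b r g.1 fun c => (A c).1) (fun s => (u s : V) + w s) =
    gaussPosR h U r u * (phiR (resForm h (perp h U)) b' r (fixerToPerp h U g)
      fun c => lieFixerToPerp h U (A c)) w
  simp only [phiR, sum_valued_apply, Finset.mul_sum]
  symm
  -- Choices of indices for `U^⊥` are embedded in those for `V`; off the image the terms vanish.
  refine Fintype.sum_of_injective (fun (I : Fin r × Fin q → Fin p') a => Sum.inr (I a))
    (fun I J hIJ => funext fun a => Sum.inr_injective (congrFun hIJ a)) _ _ ?_ ?_
  · intro I hI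
    obtain ⟨a, i, hi⟩ := exists_eq_inl_of_notMem_range hI
    rw [wedge_eq_zero _ _ a, zero_mul]
    intro c
    simp [xiR, hi, (hA.repr_lieFixer (A c) a.2).1 i]
  · intro I
    have e1 : (wedge fun a => xiR (resForm h (perp h U)) b' (I a) a.2)
        (fun c => lieFixerToPerp h U (A c)) =
        (wedge fun a => xiR h b (Sum.inr (I a)) a.2) fun c => (A c).1 := by
      change Matrix.det _ = Matrix.det _
      congr 1
      ext c a
      exact congrArg Complex.ofReal ((hA.repr_lieFixer (A c) a.2).2 (I a)).symm
    rw [e1]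
    simp only [actR, fixer_inv_add, hA.coeffR_add]
    ring

end Orthogonal


/-! ### Gaussian integrals for the projection to the Fock space. -/

section GaussianIntegrals

open MeasureTheory

/-- Completing squares gives `½ exp((d² + e²)/(8π))`. The hypothesis says that the linear term is a
multiple of `z` or of its conjugate, and then the exponent vanishes. -/
theorem integral_cexp_gaussian_of_sq_eq_neg_sq {d e : ℂ} (hde : e ^ 2 = -d ^ 2) :
    ∫ z : ℂ, Complex.exp (-(2 * Real.pi) * (z.re ^ 2 + z.im ^ 2) + d * z.re + e * z.im) = 1 / 2 := by
  have hre : (-(2 * (Real.pi : ℂ))).re < 0 := by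
    simp [Real.pi_pos]
  have hpi : (Real.pi : ℂ) ≠ 0 := by exact_mod_cast Real.pi_ne_zero
  have I1 : ∀ d : ℂ, ∫ x : ℝ, Complex.exp (-(2 * Real.pi) * x ^ 2 + d * x) =
      (1 / 2 : ℂ) ^ (1 / 2 : ℂ) * Complex.exp (d ^ 2 / (8 * Real.pi)) := by
    intro d
    have := integral_cexp_quadratic hre d 0
    simp only [add_zero, zero_sub] at this
    rw [this]
    congr 2
    · field_simp
    · field_simp
      ring
  rw [← (Complex.volume_preserving_equiv_real_prod.symm).integral_comp
    Complex.measurableEquivRealProd.symm.measurableEmbedding]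
  have e1 : ∀ z : ℝ × ℝ, Complex.exp (-(2 * Real.pi) *
      (((Complex.measurableEquivRealProd.symm z).re : ℂ) ^ 2 +
        ((Complex.measurableEquivRealProd.symm z).im : ℂ) ^ 2) +
      d * (Complex.measurableEquivRealProd.symm z).re +
      e * (Complex.measurableEquivRealProd.symm z).im) =
      Complex.exp (-(2 * Real.pi) * z.1 ^ 2 + d * z.1) *
        Complex.exp (-(2 * Real.pi) * z.2 ^ 2 + e * z.2) := by
    intro z
    rw [← Complex.exp_add]
    simp only [Complex.measurableEquivRealProd_symm_apply]
    congr 1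
    ring
  simp only [e1]
  rw [Measure.volume_eq_prod, integral_prod_mul (fun x : ℝ => Complex.exp (-(2 * Real.pi) * x ^ 2 + d * x))
    (fun x : ℝ => Complex.exp (-(2 * Real.pi) * x ^ 2 + e * x)), I1, I1, hde]
  rw [mul_mul_mul_comm, ← Complex.exp_add, ← Complex.cpow_add _ _ (by norm_num)]
  norm_num
  rw [neg_div, add_neg_cancel, Complex.exp_zero]

/-- The reproducing property of the Fock space of `ℂ`, for constant functions. -/
theorem integral_fock_one (c : Bool) (w : ℂ) :
    ∫ z : ℂ, Complex.exp (-(Real.pi : ℂ) * (2 * (conj z * z))) *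
      Complex.exp (Real.pi * conjIf c (2 * (conj z * w))) = 1 / 2 := by
  cases c
  · rw [← integral_cexp_gaussian_of_sq_eq_neg_sq (d := 2 * Real.pi * w)
      (e := -Complex.I * (2 * Real.pi * w))
      (by rw [mul_pow, neg_sq, Complex.I_sq]; ring)]
    congr 1
    funext z
    rw [← Complex.exp_add]
    congr 1
    simp only [conjIf, Bool.false_eq_true, if_false]
    rw [← Complex.normSq_eq_conj_mul_self, Complex.normSq_apply]
    have hz : conj z = z.re - z.im * Complex.I := by
      apply Complex.ext <;> simp
    rw [hz]
    push_cast
    ring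
  · rw [← integral_cexp_gaussian_of_sq_eq_neg_sq (d := 2 * Real.pi * conj w)
      (e := Complex.I * (2 * Real.pi * conj w))
      (by rw [mul_pow, Complex.I_sq]; ring)]
    congr 1
    funext z
    rw [← Complex.exp_add]
    congr 1
    simp only [conjIf, if_true]
    rw [← Complex.normSq_eq_conj_mul_self, Complex.normSq_apply]
    rw [map_mul, map_mul, Complex.conj_conj, Complex.conj_ofNat]
    conv_lhs => enter [2, 2, 2, 1]; rw [← Complex.re_add_im z]
    push_cast
    ring

theorem conjIf_sum {ι : Type*} (s : Finset ι) (c : Bool) (f : ι → ℂ) :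
    conjIf c (∑ i ∈ s, f i) = ∑ i ∈ s, conjIf c (f i) := by
  cases c <;> simp [conjIf]

theorem conjIf_add (c : Bool) (z w : ℂ) : conjIf c (z + w) = conjIf c z + conjIf c w := by
  cases c <;> simp [conjIf]

theorem conjIf_zero (c : Bool) : conjIf c 0 = 0 := by
  cases c <;> simp [conjIf]

/-- The point is independence of `w`: the value at `w = 0` is the `U`-part of the normalization in
`actC`. -/
theorem integral_fock_pi (c : Bool) {k l : ℕ} (w : Fin k → Fin l → ℂ) :
    ∫ z : Fin k → Fin l → ℂ, Complex.exp (-(Real.pi : ℂ) * (2 * ∑ a, ∑ i, conj (z a i) * z a i)) *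
      Complex.exp (Real.pi * conjIf c (2 * ∑ a, ∑ i, conj (z a i) * w a i)) =
      ((1 / 2) ^ l) ^ k := by
  simp only [Finset.mul_sum, conjIf_sum, Complex.exp_sum, ← Finset.prod_mul_distrib]
  rw [integral_fintype_prod_volume_eq_prod (fun (a : Fin k) (z : Fin l → ℂ) =>
    ∏ i, Complex.exp (-(Real.pi : ℂ) * (2 * (conj (z i) * z i))) *
      Complex.exp (Real.pi * conjIf c (2 * (conj (z i) * w a i))))]
  have : ∀ a : Fin k, ∫ z : Fin l → ℂ,
      ∏ i, Complex.exp (-(Real.pi : ℂ) * (2 * (conj (z i) * z i))) *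
        Complex.exp (Real.pi * conjIf c (2 * (conj (z i) * w a i))) = (1 / 2) ^ l := by
    intro a
    rw [integral_fintype_prod_volume_eq_prod (fun (i : Fin l) (z : ℂ) =>
      Complex.exp (-(Real.pi : ℂ) * (2 * (conj z * z))) *
        Complex.exp (Real.pi * conjIf c (2 * (conj z * w a i))))]
    simp only [integral_fock_one, Finset.prod_const, Finset.card_univ, Fintype.card_fin]
  simp only [this, Finset.prod_const, Finset.card_univ, Fintype.card_fin]

/-- Coordinates on `(U ⊕ U^⊥)^S` from coordinates on `U^S` and `(U^⊥)^S`. -/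
def joinCoord {S α β γ : Type*} (z : S → α → ℂ) (y : S → β ⊕ γ → ℂ) : S → (α ⊕ β) ⊕ γ → ℂ :=
  fun a => Sum.elim (Sum.elim (z a) (y a ∘ Sum.inl)) (y a ∘ Sum.inr)

/-- `joinCoord` only relabels coordinates, hence preserves Lebesgue measure; being a measurable
equivalence, it allows an arbitrary `G`. -/
theorem integral_joinCoord {S α β γ : Type*} [Fintype S] [Fintype α] [Fintype β] [Fintype γ]
    (G : (S → (α ⊕ β) ⊕ γ → ℂ) → ℂ) :
    ∫ y, G y = ∫ z : (S → α → ℂ) × (S → β ⊕ γ → ℂ), G (joinCoord z.1 z.2) := by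
  let e₁ := (MeasurableEquiv.arrowProdEquivProdArrow (α → ℂ) (β ⊕ γ → ℂ) S).symm
  let e₂ := (MeasurableEquiv.sumPiEquivProdPi fun _ : α ⊕ (β ⊕ γ) => ℂ).symm
  let e₃ := MeasurableEquiv.piCongrLeft (fun _ : (α ⊕ β) ⊕ γ => ℂ) (Equiv.sumAssoc α β γ).symm
  have h₁ : MeasurePreserving e₁ :=
    (volume_measurePreserving_arrowProdEquivProdArrow (α → ℂ) (β ⊕ γ → ℂ) S).symm
  have h₂ : MeasurePreserving e₂ := volume_measurePreserving_sumPiEquivProdPi_symm _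
  have h₃ : MeasurePreserving e₃ := volume_measurePreserving_piCongrLeft _ _
  have h₄ : MeasurePreserving (MeasurableEquiv.piCongrRight fun _ : S => e₂.trans e₃) :=
    volume_preserving_pi fun _ => h₃.comp h₂
  have h₅ : MeasurePreserving (e₁.trans (MeasurableEquiv.piCongrRight fun _ : S => e₂.trans e₃)) :=
    h₄.comp h₁
  rw [← h₅.integral_comp']
  congr 1
  funext z
  congr 1
  funext a d
  obtain ⟨d, rfl⟩ := (Equiv.sumAssoc α β γ).symm.surjective d
  change (MeasurableEquiv.piCongrLeft (fun _ : (α ⊕ β) ⊕ γ => ℂ) (Equiv.sumAssoc α β γ).symm) _ _ = _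
  rw [MeasurableEquiv.piCongrLeft_apply_apply]
  rcases d with d | d | d <;> rfl

end GaussianIntegrals


/-! ### Restriction in the unitary case. -/

section Unitary

open MeasureTheory

variable {V : Type*} [AddCommGroup V] [Module ℂ V]
  {h : V →ₗ⋆[ℂ] V →ₗ[ℂ] ℂ} {U : Submodule ℂ V} {l p' q : ℕ}
  {b : Module.Basis ((Fin l ⊕ Fin p') ⊕ Fin q) ℂ V}
  {b' : Module.Basis (Fin p' ⊕ Fin q) ℂ (perp h U)}

/-- The Gaussian of `U` on `U^m`. -/
def gaussU (h : V →ₗ⋆[ℂ] V →ₗ[ℂ] ℂ) (U : Submodule ℂ V) {m : ℕ} (u : Fin m → U) : ℂ :=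
  Complex.exp (-(Real.pi : ℂ) * ∑ a, h (u a : V) (u a : V))

theorem Adapted.gaussC_add (hA : Adapted h U b b') (m k : ℕ) (u : Fin m ⊕ Fin k → U)
    (w : Fin m ⊕ Fin k → perp h U) :
    gaussC b m k (fun s => (u s : V) + w s) =
      gaussU h U (fun a => u (Sum.inl a)) * gaussC b' m k w := by
  simp only [gaussC, gaussU, Fintype.sum_sum_type, hA.repr_add_inl, hA.repr_add_pos,
    hA.repr_add_neg, hA.apply_self, Finset.sum_add_distrib]
  push_cast
  rw [← Complex.exp_add]
  congr 1
  simp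
  ring

/-- Used with `z = 1` and `z = i`, the two real directions in a Wirtinger derivative. -/
theorem Adapted.lineDeriv_add (hA : Adapted h U b b') {S : Type*} [DecidableEq S] (s : S)
    (i : Fin p') (z : ℂ) {f : Fun S V} {f' : Fun S (perp h U)} {γ : ℂ} {u : S → U}
    (hf : ∀ w : S → perp h U, f (fun s => (u s : V) + w s) = γ * f' w) (w : S → perp h U) :
    lineDeriv ℝ f (fun s => (u s : V) + w s) (z • Pi.single s (b (Sum.inl (Sum.inr i)))) =
      γ * lineDeriv ℝ f' w (z • Pi.single s (b' (Sum.inl i))) := by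
  apply lineDeriv_const_mul_comp
  intro t
  rw [← hf]
  congr 1
  funext a
  by_cases ha : a = s
  · subst ha; simp [hA.pos, add_assoc]
  · simp [ha]

theorem Adapted.createC_add (hA : Adapted h U b b') (c : Bool) {m k : ℕ} (a : Lab m k q)
    (i : Fin p') {f : Fun (Fin m ⊕ Fin k) V} {f' : Fun (Fin m ⊕ Fin k) (perp h U)} {γ : ℂ}
    {u : Fin m ⊕ Fin k → U}
    (hf : ∀ w : Fin m ⊕ Fin k → perp h U, f (fun s => (u s : V) + w s) = γ * f' w)
    (w : Fin m ⊕ Fin k → perp h U) :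
    createC b c a (Sum.inr i) f (fun s => (u s : V) + w s) = γ * createC b' c a i f' w := by
  rcases a with ⟨a, j, _ | _⟩ | ⟨a, j⟩
  · have e1 := hA.lineDeriv_add (Sum.inl a) i 1 hf w
    have e2 := hA.lineDeriv_add (Sum.inl a) i Complex.I hf w
    simp only [one_smul] at e1
    simp only [createC, wirtBar, e1, e2, hf, hA.repr_add_pos]
    ring
  · have e1 := hA.lineDeriv_add (Sum.inl a) i 1 hf w
    have e2 := hA.lineDeriv_add (Sum.inl a) i Complex.I hf w
    simp only [one_smul] at e1
    simp only [createC, wirt, e1, e2, hf, hA.repr_add_pos]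
    ring
  · simp only [createC, hf, hA.repr_add_pos]
    ring

theorem Adapted.coeffC_add (hA : Adapted h U b b') (c : Bool) (m k : ℕ) (I : Lab m k q → Fin p')
    (u : Fin m ⊕ Fin k → U) (w : Fin m ⊕ Fin k → perp h U) :
    coeffC b c m k (fun a => Sum.inr (I a)) (fun s => (u s : V) + w s) =
      gaussU h U (fun a => u (Sum.inl a)) * coeffC b' c m k I w := by
  unfold coeffC
  induction labs m k q generalizing w with
  | nil => exact hA.gaussC_add m k u w
  | cons a L ih => exact hA.createC_add c a (I a) ih w

/-- Since `o ⊂ U^⊥` and `g` preserves `U^⊥`, the `o`-`o` block can be read there. -/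
theorem Adapted.detNeg_eq (hA : Adapted h U b b') (g : fixer h U) :
    detNeg h b g.1 = detNeg (resForm h (perp h U)) b' (fixerToPerp h U g) := by
  unfold detNeg
  congr 1
  ext j j'
  simp only [Matrix.of_apply]
  rw [← hA.neg]
  exact (hA.repr_perp ((fixerToPerp h U g).1 (b' (Sum.inr j')))).2.2 j

/-- The vectors of `U^k` with given coordinates. -/
def Adapted.ofCoordU (hA : Adapted h U b b') {k : ℕ} (z : Fin k → Fin l → ℂ) : Fin k → U :=
  fun a => ∑ i, z a i • ⟨b (Sum.inl (Sum.inl i)), hA.mem i⟩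

theorem Adapted.repr_ofCoordU (hA : Adapted h U b b') {k : ℕ} (z : Fin k → Fin l → ℂ)
    (a : Fin k) (i : Fin l) :
    b.repr (hA.ofCoordU z a : V) (Sum.inl (Sum.inl i)) = z a i := by
  classical
  simp [Adapted.ofCoordU, Finsupp.single_apply]

theorem Adapted.ofCoord_joinCoord (hA : Adapted h U b b') {k : ℕ} (z : Fin k → Fin l → ℂ)
    (y : Fin k → Fin p' ⊕ Fin q → ℂ) (a : Fin k) :
    ofCoord b (joinCoord z y) a = (hA.ofCoordU z a : V) + (ofCoord b' y a : perp h U) := by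
  simp only [ofCoord, joinCoord, Adapted.ofCoordU, Module.Basis.equivFun_symm_apply,
    Fintype.sum_sum_type, Submodule.coe_add, Submodule.coe_sum, Submodule.coe_smul, hA.pos, hA.neg,
    Sum.elim_inl, Sum.elim_inr, Function.comp_apply, add_assoc]

theorem Adapted.fockForm_add (hA : Adapted h U b b') {k : ℕ} (u v : Fin k → U)
    (w x : Fin k → perp h U) :
    fockForm b (fun a => (u a : V) + w a) (fun a => (v a : V) + x a) =
      2 * ∑ a, ∑ i, conj (b.repr (u a : V) (Sum.inl (Sum.inl i))) *
        b.repr (v a : V) (Sum.inl (Sum.inl i)) + fockForm b' w x := by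
  simp only [fockForm, Fintype.sum_sum_type, hA.repr_add_inl, hA.repr_add_pos, hA.repr_add_neg,
    Finset.sum_add_distrib]
  ring

/-- The projection to the Fock space is trivial in the variables of `U`. -/
theorem Adapted.actC_add (hA : Adapted h U b b') (c : Bool) {m k : ℕ} (g : fixer h U)
    {f : Fun (Fin m ⊕ Fin k) V} {f' : Fun (Fin m ⊕ Fin k) (perp h U)} {γ : (Fin m → U) → ℂ}
    (hf : ∀ (u : Fin m ⊕ Fin k → U) (w : Fin m ⊕ Fin k → perp h U),
      f (fun s => (u s : V) + w s) = γ (fun a => u (Sum.inl a)) * f' w)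
    (u : Fin m ⊕ Fin k → U) (w : Fin m ⊕ Fin k → perp h U) :
    actC h b c g.1 f (fun s => (u s : V) + w s) = γ (fun a => u (Sum.inl a)) *
      actC (resForm h (perp h U)) b' c (fixerToPerp h U g) f' w := by
  set G := (fixerToPerp h U g)⁻¹ with hG
  -- The normalizing integral splits off its `U`-part, `integral_fock_pi` at `w = 0`.
  have hnorm : ∫ y : Fin k → (Fin l ⊕ Fin p') ⊕ Fin q → ℂ,
      Complex.exp (-(Real.pi : ℂ) * fockForm b (ofCoord b y) (ofCoord b y)) =
      ((1 / 2) ^ l) ^ k * ∫ y : Fin k → Fin p' ⊕ Fin q → ℂ,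
        Complex.exp (-(Real.pi : ℂ) * fockForm b' (ofCoord b' y) (ofCoord b' y)) := by
    rw [integral_joinCoord, ← integral_fock_pi c (0 : Fin k → Fin l → ℂ), ← integral_prod_mul]
    congr 1
    funext z
    rw [funext (hA.ofCoord_joinCoord z.1 z.2), hA.fockForm_add]
    simp only [hA.repr_ofCoordU, mul_add, Complex.exp_add]
    simp [conjIf_zero]
  have hint : ∫ y : Fin k → (Fin l ⊕ Fin p') ⊕ Fin q → ℂ,
      f (Sum.elim (fun a => (g.1⁻¹).1 ((u (Sum.inl a) : V) + w (Sum.inl a)))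
        (fun a => (g.1⁻¹).1 (ofCoord b y a))) *
      Complex.exp (-((Real.pi : ℂ) / 2) *
        (fockForm b (fun a => (g.1⁻¹).1 (ofCoord b y a)) (fun a => (g.1⁻¹).1 (ofCoord b y a))
          + fockForm b (ofCoord b y) (ofCoord b y))) *
      Complex.exp ((Real.pi : ℂ) *
        conjIf c (fockForm b (ofCoord b y) (fun a => (u (Sum.inr a) : V) + w (Sum.inr a)))) =
      ((1 / 2) ^ l) ^ k * ∫ y : Fin k → Fin p' ⊕ Fin q → ℂ,
        γ (fun a => u (Sum.inl a)) * (f' (Sum.elim (fun a => G.1 (w (Sum.inl a)))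
          (fun a => G.1 (ofCoord b' y a))) *
        Complex.exp (-((Real.pi : ℂ) / 2) *
          (fockForm b' (fun a => G.1 (ofCoord b' y a)) (fun a => G.1 (ofCoord b' y a))
            + fockForm b' (ofCoord b' y) (ofCoord b' y))) *
        Complex.exp ((Real.pi : ℂ) *
          conjIf c (fockForm b' (ofCoord b' y) (fun a => w (Sum.inr a))))) := by
    -- The constant is rewritten as the `U`-integral at the point `u`, so that both sides become
    -- integrals over the same product and the integrands can be compared.
    rw [integral_joinCoord, ← integral_fock_pi c
      (fun a i => b.repr (u (Sum.inr a) : V) (Sum.inl (Sum.inl i))), ← integral_prod_mul]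
    congr 1
    funext z
    -- `γ` sees only the Schrödinger variables, so it is unaffected by the integration variable
    -- `z.1` in the Fock slots.
    have hsplit : f (Sum.elim (fun a => (u (Sum.inl a) : V) + G.1 (w (Sum.inl a)))
        (fun a => (hA.ofCoordU z.1 a : V) + G.1 (ofCoord b' z.2 a))) =
        γ (fun a => u (Sum.inl a)) * f' (Sum.elim (fun a => G.1 (w (Sum.inl a)))
          (fun a => G.1 (ofCoord b' z.2 a))) := by
      have := hf (Sum.elim (fun a => u (Sum.inl a)) (hA.ofCoordU z.1))
        (Sum.elim (fun a => G.1 (w (Sum.inl a))) (fun a => G.1 (ofCoord b' z.2 a)))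
      simp only [Sum.elim_inl] at this
      rw [← this]
      congr 1
      funext s
      rcases s with s | s <;> rfl
    rw [funext (hA.ofCoord_joinCoord z.1 z.2)]
    simp only [fixer_inv_add, ← hG, hsplit, hA.fockForm_add, hA.repr_ofCoordU, conjIf_add]
    -- As `g` fixes `U`, both norms have the same `U`-part `s`; the two halves add up to the full
    -- weight `exp(-π s)`.
    have hexp : ∀ s t t' v v' : ℂ, Complex.exp (-((Real.pi : ℂ) / 2) * (s + t + (s + t'))) *
        Complex.exp (Real.pi * (v + v')) =
        (Complex.exp (-(Real.pi : ℂ) * s) * Complex.exp (Real.pi * v)) *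
        (Complex.exp (-((Real.pi : ℂ) / 2) * (t + t')) * Complex.exp (Real.pi * v')) := by
      intro s t t' v v'
      simp only [← Complex.exp_add]
      congr 1
      ring
    rw [mul_assoc, hexp]
    ring
  -- Only this constant has to cancel; the normalizing integral of `U^⊥` occurs inverted on both
  -- sides.
  have h0 : (((1 / 2 : ℂ) ^ l) ^ k) ≠ 0 := pow_ne_zero _ (pow_ne_zero _ (by norm_num))
  simp only [actC]
  rw [hint, hnorm, hA.detNeg_eq, integral_const_mul]
  simp only [← hG]
  field_simp

theorem Adapted.oneFormC_inl (hA : Adapted h U b b') (c : Bool) {m k : ℕ} (a : Lab m k q)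
    (i : Fin l) (A : lieFixer h U) : oneFormC h b c a (Sum.inl i) A.1 = 0 := by
  have hx : ∀ j, xiC h b (Sum.inl i) j A.1 = 0 := fun j => (hA.repr_lieFixer A j).1 i
  rcases a with ⟨a, j, _ | _⟩ | ⟨a, j⟩
  · simp [oneFormC, xiBarC, hx]
  · exact hx j
  · cases c <;> simp [oneFormC, xiBarC, hx]

theorem Adapted.oneFormC_inr (hA : Adapted h U b b') (c : Bool) {m k : ℕ} (a : Lab m k q)
    (i : Fin p') (A : lieFixer h U) : oneFormC h b c a (Sum.inr i) A.1 =
      oneFormC (resForm h (perp h U)) b' c a i (lieFixerToPerp h U A) := by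
  have hx : ∀ j, xiC h b (Sum.inr i) j A.1 =
      xiC (resForm h (perp h U)) b' i j (lieFixerToPerp h U A) :=
    fun j => (hA.repr_lieFixer A j).2 i
  rcases a with ⟨a, j, _ | _⟩ | ⟨a, j⟩
  · simp [oneFormC, xiBarC, hx]
  · exact hx j
  · cases c <;> simp [oneFormC, xiBarC, hx]

theorem Adapted.res_phiC (hA : Adapted h U b b') (r s : ℕ) :
    res h U (phiC h b r s) =
      tensor h U (gaussPosC h U r s) (phiC (resForm h (perp h U)) b' r s) := by
  classical
  funext g
  ext A x
  obtain ⟨u, w⟩ := x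
  change (phiC h b r s g.1 fun c => (A c).1) (fun s => (u s : V) + w s) =
    gaussPosC h U r s u * (phiC (resForm h (perp h U)) b' r s (fixerToPerp h U g)
      fun c => lieFixerToPerp h U (A c)) w
  simp only [phiC, mixedForm, sum_valued_apply, Finset.mul_sum]
  symm
  refine Fintype.sum_of_injective (fun (I : Lab (nS r s) (nF r s) q → Fin p') a => Sum.inr (I a))
    (fun I J hIJ => funext fun a => Sum.inr_injective (congrFun hIJ a)) _ _ ?_ ?_
  · intro I hI
    obtain ⟨a, i, hi⟩ := exists_eq_inl_of_notMem_range hI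
    rw [wedge_eq_zero _ _ a, zero_mul]
    intro c
    rw [hi, hA.oneFormC_inl]
  · intro I
    have e1 : (wedge fun a => oneFormC (resForm h (perp h U)) b' (decide (s < r)) a (I a))
        (fun c => lieFixerToPerp h U (A c)) =
        (wedge fun a => oneFormC h b (decide (s < r)) a (Sum.inr (I a))) fun c => (A c).1 := by
      change Matrix.det _ = Matrix.det _
      congr 1
      ext c a
      exact (hA.oneFormC_inr _ a (I a) (A c)).symm
    rw [e1, hA.actC_add _ g (hA.coeffC_add _ _ _ I)]
    change Complex.exp _ * _ = _ * (Complex.exp _ * _)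
    ring

end Unitary

end Seesaw

end

theorem mainTheorem10 :
    -- orthogonal case: `G = O(p,q)`, `G' = Sp(2r)`
    (∀ (V : Type*) [AddCommGroup V] [Module ℝ V] (h : V →ₗ⋆[ℝ] V →ₗ[ℝ] ℝ) (p q l r : ℕ)
      (U : Submodule ℝ V),
      Seesaw.HasSignature h p q → Seesaw.IsPosDefOn h U → Module.finrank ℝ U = l → l ≤ p →
      (∃ (b : Module.Basis ((Fin l ⊕ Fin (p - l)) ⊕ Fin q) ℝ V)
        (b' : Module.Basis (Fin (p - l) ⊕ Fin q) ℝ (Seesaw.perp h U)), Seesaw.Adapted h U b b') ∧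
      ∀ (b : Module.Basis ((Fin l ⊕ Fin (p - l)) ⊕ Fin q) ℝ V)
        (b' : Module.Basis (Fin (p - l) ⊕ Fin q) ℝ (Seesaw.perp h U)), Seesaw.Adapted h U b b' →
        Seesaw.res h U (Seesaw.phiR h b r) =
          Seesaw.tensor h U (Seesaw.gaussPosR h U r)
            (Seesaw.phiR (Seesaw.resForm h (Seesaw.perp h U)) b' r)) ∧
    -- unitary case: `G = U(p,q)`, `G' = U(r,s)`
    (∀ (V : Type*) [AddCommGroup V] [Module ℂ V] (h : V →ₗ⋆[ℂ] V →ₗ[ℂ] ℂ) (p q l r s : ℕ)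
      (U : Submodule ℂ V),
      Seesaw.HasSignature h p q → Seesaw.IsPosDefOn h U → Module.finrank ℂ U = l → l ≤ p →
      (∃ (b : Module.Basis ((Fin l ⊕ Fin (p - l)) ⊕ Fin q) ℂ V)
        (b' : Module.Basis (Fin (p - l) ⊕ Fin q) ℂ (Seesaw.perp h U)), Seesaw.Adapted h U b b') ∧
      ∀ (b : Module.Basis ((Fin l ⊕ Fin (p - l)) ⊕ Fin q) ℂ V)
        (b' : Module.Basis (Fin (p - l) ⊕ Fin q) ℂ (Seesaw.perp h U)), Seesaw.Adapted h U b b' →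
        Seesaw.res h U (Seesaw.phiC h b r s) =
          Seesaw.tensor h U (Seesaw.gaussPosC h U r s)
            (Seesaw.phiC (Seesaw.resForm h (Seesaw.perp h U)) b' r s)) := by
  refine ⟨fun V _ _ h p q l r U hsig hU hl _ => ?_, fun V _ _ h p q l r s U hsig hU hl _ => ?_⟩
  · exact ⟨Seesaw.exists_adapted hsig hU hl, fun b b' hA => hA.res_phiR r⟩
  · exact ⟨Seesaw.exists_adapted hsig hU hl, fun b b' hA => hA.res_phiC r s⟩
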